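/- Let $D\subseteq\mathbb R^2$ be a simply connected domain (a non-empty connected open set in which every closed curve can be contracted to a point within $D$), and let $P,Q:D\to\mathbb R$ be differentiable at every point of $D$. A curve in $D$ from $A$ to $B$ means a continuous, piecewise continuously differentiable path in $D$ with initial point $A$ and final point $B$; it is closed if $A=B$. Then the line integral $$\int_L P\,dx+Q\,dy=\int_{t_A}^{t_B}\bigl\{P(x(t),y(t))\,x'(t)+Q(x(t),y(t))\,y'(t)\bigr\}\,dt$$ exists for every curve $L=\{(x(t),y(t))\}$ in $D$, and the following four conditions are equivalent: (a) $\oint_C P\,dx+Q\,dy=0$ for every closed curve $C$ in $D$. (b) For any two points $A,B\in D$, the integral $\int_L P\,dx+Q\,dy$ has the same value for all curves $L$ in $D$ from $A$ to $B$. (c) $P\,dx+Q\,dy$ is an exact differential, that is, there is a function $u:D\to\mathbb R$, differentiable everywhere in $D$, with $du=P\,dx+Q\,dy$ in $D$. (d) $\dfrac{\partial P}{\partial y}=\dfrac{\partial Q}{\partial x}$ at every point of $D$. Moreover, for every function $u:D\to\mathbb R$, the relation in (c) ($u$ is differentiable in $D$ and $du=P\,dx+Q\,dy$) holds if and only if the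 partial derivatives of $u$ exist in $D$ and $\partial u/\partial x=P$, $\partial u/\partial y=Q$ there. -/

import Mathlib

namespace PlaneForm

/-- The differential expression `P dx + Q dy` on the plane: at the point `z` it is the linear
functional `(h, k) ↦ P z * h + Q z * k`. -/
noncomputable def form (P Q : ℝ × ℝ → ℝ) (z : ℝ × ℝ) : ℝ × ℝ →L[ℝ] ℝ :=
  P z • ContinuousLinearMap.fst ℝ ℝ ℝ + Q z • ContinuousLinearMap.snd ℝ ℝ ℝ

/-- A curve in the plane (a continuous path, parametrized by `[0, 1]`) is piecewise `C¹` if there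
is a partition `0 = t 0 < t 1 < ⋯ < t n = 1` such that the curve is continuously differentiable
on each closed subinterval `[t i, t (i + 1)]` (with one-sided derivatives at its end points). -/
def IsPiecewiseC1 {A B : ℝ × ℝ} (γ : Path A B) : Prop :=
  ∃ (n : ℕ) (t : ℕ → ℝ), t 0 = 0 ∧ t n = 1 ∧
    ∀ i < n, t i < t (i + 1) ∧ ContDiffOn ℝ 1 γ.extend (Set.Icc (t i) (t (i + 1)))

/-- `γ` is an admissible curve of integration in `D`: it is piecewise `C¹` and runs within `D`. -/
def IsCurveIn (D : Set (ℝ × ℝ)) {A B : ℝ × ℝ} (γ : Path A B) : Prop :=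
  IsPiecewiseC1 γ ∧ ∀ s, γ s ∈ D

/-- `u` is differentiable on `D` with total differential `du = P dx + Q dy` there. -/
def IsTotalDifferential (D : Set (ℝ × ℝ)) (u P Q : ℝ × ℝ → ℝ) : Prop :=
  ∀ z ∈ D, HasFDerivAt u (form P Q z) z

/-- On `D` the partial derivatives of `u` exist, and `∂u/∂x = P`, `∂u/∂y = Q`. -/
def HasPartials (D : Set (ℝ × ℝ)) (u P Q : ℝ × ℝ → ℝ) : Prop :=
  ∀ z ∈ D, HasDerivAt (fun x => u (x, z.2)) (P z) z.1 ∧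
    HasDerivAt (fun y => u (z.1, y)) (Q z) z.2

end PlaneForm

/-! The cycle is (c) → (b) → (a) → (d) → (c). Given a primitive, the fundamental theorem of calculus
on each smooth piece telescopes to `u B - u A`; comparing a closed curve with a constant one gives
(a). From (a), Morera's argument yields a primitive near each point. As `P` and `Q` are
differentiable, it has a second derivative there, whose symmetry is (d). Conversely, (d) gives a
primitive on each ball by the Poincaré lemma, which needs no continuity of the partial derivatives
of `P` and `Q`. Two local primitives differ by a locally constant function, so their translates are
the sheets of a covering of `D`. Simple connectedness gives this covering a global section, which is
a global primitive. -/

open Set Filter Topology MeasureTheory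

/-! ### Gluing local primitives by a covering space -/

section Gluing

/-- The bundle with fibre `A` (meant to be discrete) obtained by gluing the pieces `U i ×ˢ univ`
along the translations by `f i - f j`, where the differences `f i - f j` are locally constant. -/
noncomputable def translationBundleCore {X ι A : Type*} [TopologicalSpace X] [AddCommGroup A]
    [TopologicalSpace A] [DiscreteTopology A] (U : ι → Set X) (hU : ∀ i, IsOpen (U i))
    (hcov : ∀ x, ∃ i, x ∈ U i) (f : ι → X → A)
    (hf : ∀ i j, ∀ x ∈ U i ∩ U j, ∀ᶠ y in 𝓝 x, f i y - f j y = f i x - f j x) :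
    FiberBundleCore ι X A where
  baseSet := U
  isOpen_baseSet := hU
  indexAt x := (hcov x).choose
  mem_baseSet_at x := (hcov x).choose_spec
  coordChange i j x v := v + (f i x - f j x)
  coordChange_self i x _ v := by simp
  continuousOn_coordChange i j := by
    rintro ⟨x, v⟩ ⟨hx, -⟩
    have h : ∀ᶠ p : X × A in 𝓝 (x, v),
        p.2 + (f i p.1 - f j p.1) = p.2 + (f i x - f j x) :=
      (continuous_fst.tendsto (x, v)).eventually ((hf i j x hx).mono fun y hy => hy) |>.mono
        fun p hp => by rw [hp]
    have hc : ContinuousAt (fun p : X × A => p.2 + (f i x - f j x)) (x, v) :=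
      ((continuous_of_discreteTopology (f := fun a : A => a + (f i x - f j x))).comp
        continuous_snd).continuousAt
    exact (hc.congr (h.mono fun p hp => hp.symm)).continuousWithinAt
  coordChange_comp i j k x _ v := by abel

/-- On a simply connected space, functions `f i : U i → A` on the members of an open cover whose
differences are locally constant come from one global function, up to locally constant functions. -/
theorem exists_eventually_sub_eq_of_simplyConnectedSpace {X ι A : Type*} [TopologicalSpace X]
    [SimplyConnectedSpace X] [LocallyPathConnectedSpace X] [AddCommGroup A]
    (U : ι → Set X) (hU : ∀ i, IsOpen (U i)) (hcov : ∀ x, ∃ i, x ∈ U i) (f : ι → X → A)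
    (hf : ∀ i j, ∀ x ∈ U i ∩ U j, ∀ᶠ y in 𝓝 x, f i y - f j y = f i x - f j x) :
    ∃ u : X → A, ∀ i, ∀ x ∈ U i, ∀ᶠ y in 𝓝 x, u y - f i y = u x - f i x := by
  -- With discrete fibre the bundle is a covering, and continuous maps to the fibre are locally
  -- constant.
  let : TopologicalSpace A := ⊥
  have : DiscreteTopology A := ⟨rfl⟩
  let Z := translationBundleCore U hU hcov f hf
  have cov : IsCoveringMap (Bundle.TotalSpace.proj : Z.TotalSpace → X) :=
    IsFiberBundle.isCoveringMap fun x => ⟨Z.localTrivAt x, Z.mem_localTrivAt_baseSet x⟩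
  obtain ⟨x₀⟩ : Nonempty X := inferInstance
  obtain ⟨s, ⟨-, hs⟩, -⟩ := cov.existsUnique_continuousMap_lifts (ContinuousMap.id X) x₀
    (⟨x₀, (0 : A)⟩ : Z.TotalSpace) rfl
  have hs' : ∀ x, (s x).proj = x := fun x => congrFun hs x
  let c : X → A := fun x => (s x).snd
  -- The chosen chart at `x` may jump with `x`; adding its `f` compensates. In chart `i` the section
  -- has coordinate `u - f i`, which is therefore locally constant on `U i`.
  refine ⟨fun x => c x + f (Z.indexAt x) x, fun i x hx => ?_⟩
  have key : ∀ y, (Z.localTriv i (s y)).2 = c y + (f (Z.indexAt y) y - f i y) := by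
    intro y
    change c y + (f (Z.indexAt (s y).proj) (s y).proj - f i (s y).proj) = _
    rw [hs']
  have hcont : ContinuousAt (fun y => (Z.localTriv i (s y)).2) x := by
    have h1 : ContinuousAt (Z.localTriv i) (s x) :=
      (Z.localTriv i).continuousAt (by
        rw [Z.mem_localTriv_source, hs']
        exact hx)
    exact continuous_snd.continuousAt.comp (ContinuousAt.comp (f := s) h1 s.continuous.continuousAt)
  have hev : ∀ᶠ y in 𝓝 x, (Z.localTriv i (s y)).2 = (Z.localTriv i (s x)).2 :=
    hcont.eventually (p := (· = _)) (by rw [nhds_discrete]; exact mem_pure.2 rfl)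
  filter_upwards [hev] with y hy
  rw [key, key] at hy
  simpa [add_sub_assoc] using hy

end Gluing

/-- If a `1`-form on a simply connected open set has a primitive near every point, then it has
a primitive. -/
theorem IsSimplyConnected.exists_forall_hasFDerivAt {E F : Type*} [NormedAddCommGroup E]
    [NormedSpace ℝ E] [NormedAddCommGroup F] [NormedSpace ℝ F] {D : Set E}
    (hDs : IsSimplyConnected D) (hDo : IsOpen D) {ω : E → E →L[ℝ] F}
    (h : ∀ z ∈ D, ∃ r > 0, ∃ f : E → F, ∀ y ∈ Metric.ball z r, HasFDerivAt f (ω y) y) :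
    ∃ u : E → F, ∀ z ∈ D, HasFDerivAt u (ω z) z := by
  classical
  have := hDs.simplyConnectedSpace
  have := hDo.locallyPathConnectedSpace
  choose! r hr f hf using h
  obtain ⟨u, hu⟩ := exists_eventually_sub_eq_of_simplyConnectedSpace (X := D)
    (fun i : D => (↑) ⁻¹' Metric.ball (i : E) (r i))
    (fun i => Metric.isOpen_ball.preimage continuous_subtype_val)
    (fun x => ⟨x, Metric.mem_ball_self (hr x x.2)⟩) (fun i x => f i x) (by
      rintro i j x ⟨hi, hj⟩
      obtain ⟨ε, hε, hsub⟩ := Metric.isOpen_iff.1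
        ((Metric.isOpen_ball (x := (i : E)) (ε := r i)).inter
          (Metric.isOpen_ball (x := (j : E)) (ε := r j))) x ⟨hi, hj⟩
      have hd : ∀ y ∈ Metric.ball (x : E) ε,
          HasFDerivWithinAt (fun y => f i y - f j y) (0 : E →L[ℝ] F) (Metric.ball (x : E) ε) y := by
        intro y hy
        have := (hf i i.2 y (hsub hy).1).sub (hf j j.2 y (hsub hy).2)
        rw [sub_self] at this
        exact this.hasFDerivWithinAt
      have hmem : ∀ᶠ y : D in 𝓝 x, (y : E) ∈ Metric.ball (x : E) ε :=
        continuous_subtype_val.continuousAt.eventually (Metric.ball_mem_nhds _ hε)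
      filter_upwards [hmem] with y hy
      exact (convex_ball (x : E) ε).is_const_of_fderivWithin_eq_zero (𝕜 := ℝ)
        (fun z hz => (hd z hz).differentiableWithinAt)
        (fun z hz => (hd z hz).fderivWithin (Metric.isOpen_ball.uniqueDiffWithinAt hz))
        hy (Metric.mem_ball_self hε))
  refine ⟨fun z => if hz : z ∈ D then u ⟨z, hz⟩ else 0, fun z hz => ?_⟩
  have h1 := hu ⟨z, hz⟩ ⟨z, hz⟩ (Metric.mem_ball_self (hr z hz))
  have h2 : ∀ᶠ y in 𝓝 z,
      (if hy : y ∈ D then u ⟨y, hy⟩ else 0) = f z y + (u ⟨z, hz⟩ - f z z) := by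
    rw [nhds_subtype_eq_comap, eventually_comap] at h1
    filter_upwards [h1, hDo.mem_nhds hz] with y hy hyD
    have := hy ⟨y, hyD⟩ rfl
    simp only [hyD, dif_pos]
    rw [← this]
    abel
  exact ((hf z hz z (Metric.mem_ball_self (hr z hz))).add_const _).congr_of_eventuallyEq h2

/-! ### The form, its derivative and partial derivatives -/

namespace PlaneForm

variable {D : Set (ℝ × ℝ)} {u P Q : ℝ × ℝ → ℝ} {A B C : ℝ × ℝ}

@[simp]
theorem form_apply (z v : ℝ × ℝ) : form P Q z v = P z * v.1 + Q z * v.2 := by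
  simp [form]

theorem hasFDerivAt_form {z : ℝ × ℝ} (hP : DifferentiableAt ℝ P z)
    (hQ : DifferentiableAt ℝ Q z) :
    HasFDerivAt (form P Q) ((fderiv ℝ P z).smulRight (ContinuousLinearMap.fst ℝ ℝ ℝ) +
      (fderiv ℝ Q z).smulRight (ContinuousLinearMap.snd ℝ ℝ ℝ)) z :=
  (hP.hasFDerivAt.smul_const (ContinuousLinearMap.fst ℝ ℝ ℝ)).add
    (hQ.hasFDerivAt.smul_const (ContinuousLinearMap.snd ℝ ℝ ℝ))

theorem fderiv_form_apply {z : ℝ × ℝ} (hP : DifferentiableAt ℝ P z)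
    (hQ : DifferentiableAt ℝ Q z) (v w : ℝ × ℝ) :
    fderiv ℝ (form P Q) z v w = fderiv ℝ P z v * w.1 + fderiv ℝ Q z v * w.2 := by
  rw [(hasFDerivAt_form hP hQ).fderiv]
  simp

theorem hasDerivAt_fst_of_hasFDerivAt {f : ℝ × ℝ → ℝ} {f' : ℝ × ℝ →L[ℝ] ℝ} {z : ℝ × ℝ}
    (h : HasFDerivAt f f' z) : HasDerivAt (fun x => f (x, z.2)) (f' (1, 0)) z.1 :=
  HasFDerivAt.comp_hasDerivAt (f := fun x : ℝ => (x, z.2)) z.1 h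
    ((hasDerivAt_id z.1).prodMk (hasDerivAt_const z.1 z.2))

theorem hasDerivAt_snd_of_hasFDerivAt {f : ℝ × ℝ → ℝ} {f' : ℝ × ℝ →L[ℝ] ℝ} {z : ℝ × ℝ}
    (h : HasFDerivAt f f' z) : HasDerivAt (fun y => f (z.1, y)) (f' (0, 1)) z.2 :=
  HasFDerivAt.comp_hasDerivAt (f := fun y : ℝ => (z.1, y)) z.2 h
    ((hasDerivAt_const z.2 z.1).prodMk (hasDerivAt_id z.2))

/-- For the converse direction, the partial derivatives of `u` are the continuous functions `P` and
`Q`, and continuous partials imply differentiability. -/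
theorem isTotalDifferential_iff_hasPartials (hDo : IsOpen D)
    (hP : ContinuousOn P D) (hQ : ContinuousOn Q D) :
    IsTotalDifferential D u P Q ↔ HasPartials D u P Q := by
  refine ⟨fun h z hz => ?_, fun h z hz => ?_⟩
  · have h1 := hasDerivAt_fst_of_hasFDerivAt (h z hz)
    have h2 := hasDerivAt_snd_of_hasFDerivAt (h z hz)
    simp only [form_apply, mul_one, mul_zero, add_zero, zero_add] at h1 h2
    exact ⟨h1, h2⟩
  · have hD := hDo.mem_nhds hz
    have key := hasStrictFDerivAt_uncurry_coprod (𝕜 := ℝ) (u := z) (f := fun x y => u (x, y))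
      (f₁ := fun x y => P (x, y) • ContinuousLinearMap.id ℝ ℝ)
      (f₂ := fun x y => Q (x, y) • ContinuousLinearMap.id ℝ ℝ)
      (by
        filter_upwards [hD] with v hv
        convert! (h v hv).1.hasFDerivAt using 1
        ext
        simp [Function.HasUncurry.uncurry])
      (by
        filter_upwards [hD] with v hv
        convert! (h v hv).2.hasFDerivAt using 1
        ext
        simp [Function.HasUncurry.uncurry])
      ((hP.continuousAt hD).smul continuousAt_const)
      ((hQ.continuousAt hD).smul continuousAt_const)
    convert! key.hasFDerivAt using 1

/-- A bilinear form on the plane is symmetric as soon as it is so on the two basis vectors, where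
its values are `∂P/∂y` and `∂Q/∂x`. -/
theorem fderiv_form_symmetric_iff {z : ℝ × ℝ} (hP : DifferentiableAt ℝ P z)
    (hQ : DifferentiableAt ℝ Q z) :
    (∀ v w, fderiv ℝ (form P Q) z v w = fderiv ℝ (form P Q) z w v) ↔
      deriv (fun y => P (z.1, y)) z.2 = deriv (fun x => Q (x, z.2)) z.1 := by
  rw [(hasDerivAt_snd_of_hasFDerivAt hP.hasFDerivAt).deriv,
    (hasDerivAt_fst_of_hasFDerivAt hQ.hasFDerivAt).deriv]
  simp only [fderiv_form_apply hP hQ]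
  refine ⟨fun h => by simpa using h (0, 1) (1, 0), fun h v w => ?_⟩
  have hdec : ∀ (L : ℝ × ℝ →L[ℝ] ℝ) (v : ℝ × ℝ), L v = v.1 * L (1, 0) + v.2 * L (0, 1) := by
    intro L v
    conv_lhs => rw [show v = v.1 • ((1 : ℝ), (0 : ℝ)) + v.2 • ((0 : ℝ), (1 : ℝ)) by ext <;> simp]
    simp only [map_add, map_smul, smul_eq_mul]
  rw [hdec _ v, hdec (fderiv ℝ Q z) v, hdec _ w, hdec (fderiv ℝ Q z) w, h]
  ring

/-! ### Piecewise smooth curves and their integrals -/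

section Curves

theorem isPiecewiseC1_of_contDiffOn {γ : Path A B} (h : ContDiffOn ℝ 1 γ.extend (Icc 0 1)) :
    IsPiecewiseC1 γ := by
  refine ⟨1, fun i => i, by simp, by simp, fun i hi => ?_⟩
  obtain rfl : i = 0 := by omega
  simpa using h

theorem isPiecewiseC1_refl (A : ℝ × ℝ) : IsPiecewiseC1 (Path.refl A) :=
  isPiecewiseC1_of_contDiffOn (contDiffOn_const (c := A))

theorem isPiecewiseC1_segment (A B : ℝ × ℝ) : IsPiecewiseC1 (Path.segment A B) := by
  refine isPiecewiseC1_of_contDiffOn (ContDiffOn.congr ?_ (Path.eqOn_extend_segment A B))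
  exact ContDiff.contDiffOn (by fun_prop)

theorem monotone_of_partition {t : ℕ → ℝ} {n : ℕ} (h : ∀ i < n, t i < t (i + 1)) {i j : ℕ}
    (hij : i ≤ j) (hj : j ≤ n) : t i ≤ t j := by
  induction j, hij using Nat.le_induction with
  | base => exact le_rfl
  | succ k hk ih => exact (ih (by omega)).trans (h k (by omega)).le

theorem IsPiecewiseC1.trans {γ : Path A B} {δ : Path B C} (hγ : IsPiecewiseC1 γ)
    (hδ : IsPiecewiseC1 δ) : IsPiecewiseC1 (γ.trans δ) := by
  obtain ⟨n, t, t0, tn, ht⟩ := hγ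
  obtain ⟨m, s, s0, sm, hs⟩ := hδ
  -- Both formulas give `1 / 2` at `i = n`, because `t n = 1` and `s 0 = 0`.
  let p : ℕ → ℝ := fun i => if i < n then t i / 2 else 1 / 2 + s (i - n) / 2
  have p_of_le : ∀ i ≤ n, p i = t i / 2 := by
    intro i hi
    rcases hi.lt_or_eq with hi | rfl
    · simp [p, hi]
    · simp [p, s0, tn]
  have p_of_ge : ∀ i, n ≤ i → p i = 1 / 2 + s (i - n) / 2 := fun i hi => by
    simp [p, not_lt.2 hi]
  refine ⟨n + m, p, by rw [p_of_le 0 (Nat.zero_le _), t0, zero_div],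
    by rw [p_of_ge _ (by omega), Nat.add_sub_cancel_left, sm]; norm_num, fun i hi => ?_⟩
  rcases lt_or_ge i n with hin | hin
  · rw [p_of_le i hin.le, p_of_le (i + 1) hin]
    obtain ⟨hlt, hcd⟩ := ht i hin
    have hle : t (i + 1) ≤ 1 := tn ▸ monotone_of_partition (fun i hi => (ht i hi).1) hin le_rfl
    refine ⟨by linarith, ContDiffOn.congr
      (hcd.comp (g := γ.extend) (f := fun x : ℝ => 2 * x) (by fun_prop) ?_) ?_⟩
    · rintro x ⟨hx, hx'⟩
      constructor <;> linarith
    · rintro x ⟨hx, hx'⟩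
      exact γ.extend_trans_of_le_half δ (by linarith)
  · rw [p_of_ge i hin, p_of_ge (i + 1) (by omega), Nat.sub_add_comm hin]
    obtain ⟨hlt, hcd⟩ := hs (i - n) (by omega)
    have hle : 0 ≤ s (i - n) :=
      s0 ▸ monotone_of_partition (fun i hi => (hs i hi).1) (Nat.zero_le _) (by omega)
    refine ⟨by linarith, ContDiffOn.congr
      (hcd.comp (g := δ.extend) (f := fun x : ℝ => 2 * x - 1) (by fun_prop) ?_) ?_⟩
    · rintro x ⟨hx, hx'⟩
      constructor <;> linarith
    · rintro x ⟨hx, hx'⟩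
      exact γ.extend_trans_of_half_le δ (by linarith)

theorem IsCurveIn.trans {γ : Path A B} {δ : Path B C} (hγ : IsCurveIn D γ)
    (hδ : IsCurveIn D δ) : IsCurveIn D (γ.trans δ) := by
  refine ⟨hγ.1.trans hδ.1, fun s => ?_⟩
  rw [Path.trans_apply]
  split_ifs
  exacts [hγ.2 _, hδ.2 _]

theorem isCurveIn_segment {s : Set (ℝ × ℝ)} (hs : Convex ℝ s) (hsD : s ⊆ D) (hA : A ∈ s)
    (hB : B ∈ s) : IsCurveIn D (Path.segment A B) :=
  ⟨isPiecewiseC1_segment A B, fun t => hsD (hs.lineMap_mem hA hB t.2)⟩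

theorem derivWithin_Icc_eq_deriv {f : ℝ → ℝ × ℝ} {a b x : ℝ} (hx : x ∈ Ioo a b) :
    derivWithin f (Icc a b) x = deriv f x :=
  derivWithin_of_mem_nhds (Icc_mem_nhds hx.1 hx.2)

theorem curveIntegralFun_eq_of_mem_Ioo {ω : ℝ × ℝ → ℝ × ℝ →L[ℝ] ℝ} {γ : Path A B} {x : ℝ}
    (hx : x ∈ Ioo (0 : ℝ) 1) :
    curveIntegralFun ω γ x = ω (γ.extend x) (deriv γ.extend x) := by
  rw [curveIntegralFun_def, derivWithin_Icc_eq_deriv hx]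

theorem intervalIntegrable_curveIntegralFun {ω : ℝ × ℝ → ℝ × ℝ →L[ℝ] ℝ} {γ : Path A B}
    (hω : ContinuousOn ω D) (hγ : ∀ s, γ s ∈ D) {a b : ℝ} (ha : 0 ≤ a) (hab : a < b) (hb : b ≤ 1)
    (hcd : ContDiffOn ℝ 1 γ.extend (Icc a b)) :
    IntervalIntegrable (curveIntegralFun ω γ) volume a b := by
  have hcont : ContinuousOn
      (fun x => ω (γ.extend x) (derivWithin γ.extend (Icc a b) x)) (Icc a b) :=
    (hω.comp (by fun_prop) fun _ _ => hγ _).clm_apply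
      (hcd.continuousOn_derivWithin (uniqueDiffOn_Icc hab) le_rfl)
  -- The integrand uses the derivative within `[0, 1]`, which may fail to exist at a corner; it
  -- agrees with the one-sided version off the end points, a null set.
  refine (hcont.intervalIntegrable_of_Icc (μ := volume) hab.le).congr_ae ?_
  rw [uIoc_of_le hab.le, ← restrict_Ioo_eq_restrict_Ioc]
  filter_upwards [ae_restrict_mem measurableSet_Ioo] with x hx
  rw [curveIntegralFun_eq_of_mem_Ioo ⟨ha.trans_lt hx.1, hx.2.trans_le hb⟩,
    derivWithin_Icc_eq_deriv hx]

theorem integral_curveIntegralFun_eq_sub {γ : Path A B} {ω : ℝ × ℝ → ℝ × ℝ →L[ℝ] ℝ}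
    (hω : ContinuousOn ω D) (hu : ∀ z ∈ D, HasFDerivAt u (ω z) z) (hγ : ∀ s, γ s ∈ D) {a b : ℝ}
    (ha : 0 ≤ a) (hab : a < b) (hb : b ≤ 1) (hcd : ContDiffOn ℝ 1 γ.extend (Icc a b)) :
    ∫ x in a..b, curveIntegralFun ω γ x = u (γ.extend b) - u (γ.extend a) := by
  refine intervalIntegral.integral_eq_sub_of_hasDerivAt_of_le (f := u ∘ γ.extend) hab.le ?_ ?_
    (intervalIntegrable_curveIntegralFun hω hγ ha hab hb hcd)
  · exact fun x _ => (ContinuousAt.comp (hu (γ.extend x) (hγ _)).continuousAt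
      γ.continuous_extend.continuousAt).continuousWithinAt
  · intro x hx
    rw [curveIntegralFun_eq_of_mem_Ioo ⟨ha.trans_lt hx.1, hx.2.trans_le hb⟩]
    have hd : DifferentiableAt ℝ γ.extend x :=
      (hcd.contDiffAt (Icc_mem_nhds hx.1 hx.2)).differentiableAt one_ne_zero
    exact (hu _ (hγ _)).comp_hasDerivAt x hd.hasDerivAt

theorem IsCurveIn.curveIntegrable {ω : ℝ × ℝ → ℝ × ℝ →L[ℝ] ℝ} {γ : Path A B}
    (hγ : IsCurveIn D γ) (hω : ContinuousOn ω D) : CurveIntegrable ω γ := by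
  obtain ⟨⟨n, t, t0, tn, ht⟩, hγD⟩ := hγ
  have hmono := fun i j => monotone_of_partition (fun i hi => (ht i hi).1) (i := i) (j := j)
  rw [CurveIntegrable, ← t0, ← tn]
  exact IntervalIntegrable.trans_iterate fun k hk => intervalIntegrable_curveIntegralFun hω hγD
    (t0 ▸ hmono 0 k (Nat.zero_le _) hk.le) (ht k hk).1 (tn ▸ hmono (k + 1) n hk le_rfl) (ht k hk).2

theorem IsCurveIn.curveIntegral_eq_sub {ω : ℝ × ℝ → ℝ × ℝ →L[ℝ] ℝ} {γ : Path A B}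
    (hγ : IsCurveIn D γ) (hω : ContinuousOn ω D) (hu : ∀ z ∈ D, HasFDerivAt u (ω z) z) :
    curveIntegral ω γ = u B - u A := by
  obtain ⟨⟨n, t, t0, tn, ht⟩, hγD⟩ := hγ
  have hmono := fun i j => monotone_of_partition (fun i hi => (ht i hi).1) (i := i) (j := j)
  have h0 : ∀ k < n, 0 ≤ t k := fun k hk => t0 ▸ hmono 0 k (Nat.zero_le _) hk.le
  have h1 : ∀ k < n, t (k + 1) ≤ 1 := fun k hk => tn ▸ hmono (k + 1) n hk le_rfl
  calc curveIntegral ω γ = ∫ x in t 0..t n, curveIntegralFun ω γ x := by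
        rw [t0, tn, curveIntegral_def]
    _ = ∑ k ∈ Finset.range n, ∫ x in t k..t (k + 1), curveIntegralFun ω γ x :=
      (intervalIntegral.sum_integral_adjacent_intervals fun k hk =>
        intervalIntegrable_curveIntegralFun hω hγD (h0 k hk) (ht k hk).1 (h1 k hk)
          (ht k hk).2).symm
    _ = ∑ k ∈ Finset.range n, (u (γ.extend (t (k + 1))) - u (γ.extend (t k))) :=
      Finset.sum_congr rfl fun k hk => by
        have hk := Finset.mem_range.1 hk
        exact integral_curveIntegralFun_eq_sub hω hu hγD (h0 k hk) (ht k hk).1 (h1 k hk)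
          (ht k hk).2
    _ = u B - u A := by
      rw [Finset.sum_range_sub fun k => u (γ.extend (t k)), t0, tn, γ.extend_one, γ.extend_zero]

/-- Morera's argument: a continuous form on an open set whose integrals along closed curves
vanish has a primitive on every ball in that set. -/
theorem hasFDerivAt_curveIntegral_segment {ω : ℝ × ℝ → ℝ × ℝ →L[ℝ] ℝ} (hω : ContinuousOn ω D)
    (h : ∀ (A : ℝ × ℝ) (γ : Path A A), IsCurveIn D γ → curveIntegral ω γ = 0) {c : ℝ × ℝ} {r : ℝ}
    (hr : Metric.ball c r ⊆ D) {y : ℝ × ℝ} (hy : y ∈ Metric.ball c r) :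
    HasFDerivAt (fun x => curveIntegral ω (Path.segment c x)) (ω y) y := by
  have hconv := convex_ball c r
  have hc : c ∈ Metric.ball c r := Metric.mem_ball_self (Metric.pos_of_mem_ball hy)
  have hadd : ∀ x ∈ Metric.ball c r, curveIntegral ω (Path.segment c x) =
      curveIntegral ω (Path.segment c y) + curveIntegral ω (Path.segment y x) := by
    intro x hx
    have h1 := isCurveIn_segment hconv hr hc hy
    have h2 := isCurveIn_segment hconv hr hy hx
    have h3 := isCurveIn_segment hconv hr hx hc
    -- The integral around the triangle `c → y → x → c`, which lies in the ball by convexity, is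
    -- zero.
    have h0 := h c _ ((h1.trans h2).trans h3)
    rw [curveIntegral_trans ((h1.trans h2).curveIntegrable hω) (h3.curveIntegrable hω),
      curveIntegral_trans (h1.curveIntegrable hω) (h2.curveIntegrable hω),
      ← Path.segment_symm c x, curveIntegral_symm] at h0
    linarith
  have hball := Metric.isOpen_ball.mem_nhds hy
  have hd : HasFDerivAt (fun x => curveIntegral ω (Path.segment y x)) (ω y) y :=
    HasFDerivAt.curveIntegral_segment_source' <| by
      filter_upwards [hball] with x hx
      exact (hω.mono hr).continuousAt (Metric.isOpen_ball.mem_nhds hx)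
  refine (hd.const_add (curveIntegral ω (Path.segment c y))).congr_of_eventuallyEq ?_
  filter_upwards [hball] with x hx using hadd x hx

end Curves

end PlaneForm

/-! ### The equivalence theorem -/

theorem theorem1 (D : Set (ℝ × ℝ)) (hDo : IsOpen D) (hDs : IsSimplyConnected D)
    (P Q : ℝ × ℝ → ℝ) (hP : ∀ z ∈ D, DifferentiableAt ℝ P z)
    (hQ : ∀ z ∈ D, DifferentiableAt ℝ Q z) :
    -- the line integral along every curve in `D` exists
    (∀ (A B : ℝ × ℝ) (γ : Path A B), PlaneForm.IsCurveIn D γ →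
      CurveIntegrable (PlaneForm.form P Q) γ) ∧
    -- the two forms of the equation `du = P dx + Q dy` on `D` agree
    (∀ u : ℝ × ℝ → ℝ,
      PlaneForm.IsTotalDifferential D u P Q ↔ PlaneForm.HasPartials D u P Q) ∧
    List.TFAE [
      -- (a) all closed line integrals vanish
      ∀ (A : ℝ × ℝ) (γ : Path A A), PlaneForm.IsCurveIn D γ →
        curveIntegral (PlaneForm.form P Q) γ = 0,
      -- (b) line integrals depend on the end points only
      ∀ A ∈ D, ∀ B ∈ D, ∀ γ₁ γ₂ : Path A B,
        PlaneForm.IsCurveIn D γ₁ → PlaneForm.IsCurveIn D γ₂ →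
        curveIntegral (PlaneForm.form P Q) γ₁ = curveIntegral (PlaneForm.form P Q) γ₂,
      -- (c) `P dx + Q dy` is an exact differential on `D`
      ∃ u : ℝ × ℝ → ℝ, PlaneForm.IsTotalDifferential D u P Q,
      -- (d) `∂P/∂y = ∂Q/∂x` at every point of `D`
      ∀ z ∈ D, deriv (fun y => P (z.1, y)) z.2 = deriv (fun x => Q (x, z.2)) z.1] := by
  have hωd : ∀ z ∈ D, DifferentiableAt ℝ (PlaneForm.form P Q) z := fun z hz =>
    (PlaneForm.hasFDerivAt_form (hP z hz) (hQ z hz)).differentiableAt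
  have hω : ContinuousOn (PlaneForm.form P Q) D := fun z hz =>
    (hωd z hz).continuousAt.continuousWithinAt
  refine ⟨fun A B γ hγ => hγ.curveIntegrable hω, fun u =>
    PlaneForm.isTotalDifferential_iff_hasPartials hDo
      (fun z hz => (hP z hz).continuousAt.continuousWithinAt)
      (fun z hz => (hQ z hz).continuousAt.continuousWithinAt), ?_⟩
  tfae_have 3 → 2 := by
    rintro ⟨u, hu⟩ A - B - γ₁ γ₂ h₁ h₂
    rw [h₁.curveIntegral_eq_sub hω hu, h₂.curveIntegral_eq_sub hω hu]
  tfae_have 2 → 1 := by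
    intro h A γ hγ
    have hA : A ∈ D := by simpa using hγ.2 0
    rw [h A hA A hA γ (Path.refl A) hγ ⟨PlaneForm.isPiecewiseC1_refl A, fun _ => hA⟩,
      curveIntegral_refl]
  tfae_have 1 → 4 := by
    intro h z hz
    obtain ⟨r, hr, hrD⟩ := Metric.isOpen_iff.1 hDo z hz
    -- The derivative of the form at `z` is the second derivative of a local primitive. Symmetry
    -- needs only a first derivative near `z` that is differentiable at `z`.
    exact (PlaneForm.fderiv_form_symmetric_iff (hP z hz) (hQ z hz)).1 fun v w =>
      second_derivative_symmetric_of_eventually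
        (eventually_of_mem (Metric.ball_mem_nhds z hr) fun y hy =>
          PlaneForm.hasFDerivAt_curveIntegral_segment hω h hrD hy)
        (hωd z hz).hasFDerivAt v w
  tfae_have 4 → 3 := by
    intro h
    refine hDs.exists_forall_hasFDerivAt hDo fun z hz => ?_
    obtain ⟨r, hr, hrD⟩ := Metric.isOpen_iff.1 hDo z hz
    obtain ⟨f, hf⟩ := (convex_ball z r).exists_forall_hasFDerivAt_of_fderiv_symmetric
      Metric.isOpen_ball (fun y hy => (hωd y (hrD hy)).differentiableWithinAt) fun y hy =>
        (PlaneForm.fderiv_form_symmetric_iff (hP y (hrD hy)) (hQ y (hrD hy))).2 (h y (hrD hy))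
    exact ⟨r, hr, f, hf⟩
  tfae_finish
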